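/- All graphs are finite and simple. A walk of a graph $G$ is a sequence of vertices $v_0v_1\dots v_k$ ($k \ge 0$) in which every two consecutive vertices are adjacent; vertices and edges may be repeated and the two end-vertices may coincide; its length is $k$. For a walk $W$ of $G$, let $G+W$ be the multigraph with vertex set $V(G)$ whose edge multiset consists of the edges of $G$ together with the edges of $W$, the latter taken with the multiplicity with which $W$ traverses them. The degree of a vertex in a multigraph is the number of its incident edges, counted with multiplicity. The walk $W$ is irregularising if no two adjacent vertices of $G+W$ have the same degree in $G+W$. Let $\mathrm{ML}^{\mathrm W}(G)$ be the smallest $k \ge 1$ such that $G$ has an irregularising walk of length $k$ (and $+\infty$ if there is none). Let $C_n$ denote the cycle with $n$ vertices. Then, for every integer $n \ge 3$, $$\mathrm{ML}^{\mathrm W}(C_n)=\begin{cases}3 & \text{if } n=3,\\ 2n-6 & \text{if } n\ge 4.\end{cases}$$ -/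

import Mathlib

/-- A loopless multigraph with vertex set `V`, given by its multiset of edges. -/
structure LooplessMultigraph (V : Type*) where
  /-- The edges, with multiplicity. -/
  edges : Multiset (Sym2 V)
  /-- No edge joins a vertex to itself. -/
  loopless : ∀ e ∈ edges, ¬ e.IsDiag

namespace LooplessMultigraph

variable {V : Type*} [DecidableEq V]

/-- The degree of `v`: the number of edges incident to `v`, counted with multiplicity. -/
def degree (M : LooplessMultigraph V) (v : V) : ℕ :=
  M.edges.countP (fun e => v ∈ e)

/-- A multigraph is locally irregular if no two adjacent vertices have the same degree. -/
def IsLocallyIrregular (M : LooplessMultigraph V) : Prop :=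
  ∀ u v : V, s(u, v) ∈ M.edges → M.degree u ≠ M.degree v

end LooplessMultigraph

namespace SimpleGraph

variable {V : Type*} [Fintype V] [DecidableEq V] (G : SimpleGraph V) [DecidableRel G.Adj]

/-- The multigraph `G + W`: the edges of `G`, together with the edges of the walk `W` taken with
the multiplicity with which `W` traverses them. -/
def addWalk {u v : V} (W : G.Walk u v) : LooplessMultigraph V where
  edges := G.edgeFinset.val + (W.edges : Multiset (Sym2 V))
  loopless := by
    intro e he
    rcases Multiset.mem_add.1 he with h | h
    · exact G.not_isDiag_of_mem_edgeSet (SimpleGraph.mem_edgeFinset.1 h)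
    · exact G.not_isDiag_of_mem_edgeSet (W.edges_subset_edgeSet (Multiset.mem_coe.1 h))

/-- A walk `W` of `G` is irregularising if `G + W` is locally irregular. -/
def IsIrregularisingWalk {u v : V} (W : G.Walk u v) : Prop :=
  (G.addWalk W).IsLocallyIrregular

/-- `ML^W(G)`: the smallest `k ≥ 1` such that `G` has an irregularising walk of length `k`
(vertices and edges may be repeated, the end-vertices are arbitrary and may coincide);
it is `⊤` if there is no such `k`. -/
noncomputable def minIrregularisingWalkLength : ℕ∞ :=
  sInf {k : ℕ∞ | 1 ≤ k ∧
    ∃ (u v : V) (W : G.Walk u v), G.IsIrregularisingWalk W ∧ (W.length : ℕ∞) = k}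

end SimpleGraph

/-!
Let `f i` be the number of times a walk `W` of the cycle traverses the edge between `i` and `i + 1`.
The degree of `i` in `C_n + W` is `2 + f (i - 1) + f i`, so `W` is irregularising if and only if
`f i ≠ f (i + 2)` for all `i` (`isIrregularisingWalk_cycleGraph_iff`), and the length of `W` is the
sum of `f`.

Lower bound. The traversed edges form an arc (`Walk.exists_arc`), so there are at most two
untraversed edges, and they are consecutive: three of them would include two at distance two. The
parity of `f` changes only at the ends of `W` (`Walk.even_traversals_add`). On a block of edges
where `f` is odd, two values at distance two are distinct odd numbers and add up to at least `4`,
so the block of length `k` has sum at least `2 * k - 2` (`two_mul_le_sum_add_two_of_odd`); where `f`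
is even and positive the average is at least `2`. If some edge is untraversed, there is a single
odd block, and the sum is at least `2 * n - 2 - 4`; otherwise it is at least `2 * n - 4`. For
`n = 3` the three values of `f` are distinct, so their sum is at least `0 + 1 + 2`.

Upper bound. The values `1, 1, 3, 3, 1, 1, …, 3, 3, 1, 1, 0, 0`, with up to one `2` inserted before
and up to two inserted after the odd block according to `n` modulo `4`, attain the bound, and they
are realised by a walk that goes back and forth (`exists_hasCycleWalk_traversalPattern`).
-/

namespace SimpleGraph

/-! ### Edges and degrees in the cycle -/

section CycleEdges

open scoped Fin.CommRing Fin.NatCast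

variable {n : ℕ} [NeZero n]

theorem cycleGraph_adj_iff (hn : 3 ≤ n) {u v : Fin n} :
    (cycleGraph n).Adj u v ↔ v = u + 1 ∨ u = v + 1 := by
  rw [cycleGraph_adj']
  have h1 : ((1 : Fin n) : ℕ) = 1 := by
    rw [Fin.val_one']; exact Nat.mod_eq_of_lt (by omega)
  have key : ∀ x y : Fin n, (x - y).val = 1 ↔ x = y + 1 := by
    intro x y
    rw [← h1, ← Fin.ext_iff, sub_eq_iff_eq_add, add_comm]
  rw [key, key, or_comm]

theorem fin_natCast_inj_of_lt {i j : ℕ} (hi : i < n) (hj : j < n)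
    (h : (i : Fin n) = (j : Fin n)) : i = j := by
  have := congrArg Fin.val h
  simpa [Fin.val_natCast, Nat.mod_eq_of_lt hi, Nat.mod_eq_of_lt hj] using this

theorem fin_natCast_ne_zero {i : ℕ} (hi : 0 < i) (hin : i < n) : (i : Fin n) ≠ 0 := by
  intro h
  have := fin_natCast_inj_of_lt (n := n) (i := i) (j := 0) hin (by omega) (by simpa using h)
  omega

theorem fin_natCast_self : (n : Fin n) = 0 := by
  ext; simp

theorem cycleEdge_inj (hn : 3 ≤ n) {i j : Fin n} : s(i, i + 1) = s(j, j + 1) ↔ i = j := by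
  constructor
  · intro h
    rcases Sym2.eq_iff.1 h with ⟨h, -⟩ | ⟨h1, h2⟩
    · exact h
    · exfalso
      apply fin_natCast_ne_zero (n := n) (i := 2) (by omega) (by omega)
      rw [h1] at h2
      push_cast
      linear_combination h2
  · rintro rfl; rfl

theorem mem_edgeSet_cycleGraph_iff (hn : 3 ≤ n) {e : Sym2 (Fin n)} :
    e ∈ (cycleGraph n).edgeSet ↔ ∃ i : Fin n, e = s(i, i + 1) := by
  induction e with
  | _ x y =>
    rw [mem_edgeSet, cycleGraph_adj_iff hn]
    constructor
    · rintro (rfl | rfl)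
      · exact ⟨x, rfl⟩
      · exact ⟨y, Sym2.eq_swap⟩
    · rintro ⟨i, hi⟩
      rcases Sym2.eq_iff.1 hi with ⟨rfl, rfl⟩ | ⟨rfl, rfl⟩ <;> simp

/-- The edges of a cycle incident to `v` are the one arriving at `v` and the one leaving it. -/
theorem countP_mem_eq_count_add_count (hn : 3 ≤ n) (m : Multiset (Sym2 (Fin n)))
    (hm : ∀ e ∈ m, e ∈ (cycleGraph n).edgeSet) (v : Fin n) :
    m.countP (fun e => v ∈ e) = m.count s(v - 1, v - 1 + 1) + m.count s(v, v + 1) := by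
  induction m using Multiset.induction_on with
  | empty => simp
  | cons e m ih =>
    have ih' := ih fun e he => hm e (Multiset.mem_cons_of_mem he)
    obtain ⟨i, rfl⟩ := (mem_edgeSet_cycleGraph_iff hn).1 (hm e (Multiset.mem_cons_self _ _))
    rw [Multiset.countP_cons, Multiset.count_cons, Multiset.count_cons, ih']
    have h1 : (v ∈ s(i, i + 1)) ↔ v - 1 = i ∨ v = i := by
      rw [Sym2.mem_iff, sub_eq_iff_eq_add, or_comm]
    have h2 : ¬ (v - 1 = i ∧ v = i) := by
      rintro ⟨h, rfl⟩
      apply fin_natCast_ne_zero (n := n) (i := 1) (by omega) (by omega)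
      push_cast
      linear_combination -h
    simp only [h1, cycleEdge_inj hn]
    split_ifs <;> omega

/-- The number of times a walk of the cycle traverses the edge between `i` and `i + 1`. -/
def Walk.traversals {u v : Fin n} (W : (cycleGraph n).Walk u v) (i : Fin n) : ℕ :=
  W.edges.count s(i, i + 1)

theorem Walk.traversals_cons (hn : 3 ≤ n) {u v w i : Fin n} (h : (cycleGraph n).Adj u v)
    (W : (cycleGraph n).Walk v w) (he : s(u, v) = s(i, i + 1)) (j : Fin n) :
    (Walk.cons h W).traversals j = W.traversals j + if i = j then 1 else 0 := by
  simp only [traversals, edges_cons, he, List.count_cons, beq_iff_eq, cycleEdge_inj hn]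

theorem Walk.sum_traversals (hn : 3 ≤ n) {u v : Fin n} (W : (cycleGraph n).Walk u v) :
    ∑ i, W.traversals i = W.length := by
  induction W with
  | nil => simp [traversals]
  | cons h W ih =>
    obtain ⟨i, hi⟩ := (mem_edgeSet_cycleGraph_iff hn).1 ((SimpleGraph.mem_edgeSet _).2 h)
    simp [traversals_cons hn h W hi, Finset.sum_add_distrib, ih]

/-- Two consecutive vertices `i` and `i + 1` share the edge between them, so their degrees are
compared by the edges on either side of it. -/
theorem isIrregularisingWalk_cycleGraph_iff (hn : 3 ≤ n) {u v : Fin n}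
    (W : (cycleGraph n).Walk u v) :
    (cycleGraph n).IsIrregularisingWalk W ↔ ∀ i, W.traversals i ≠ W.traversals (i + 2) := by
  have hsub : ∀ e ∈ ((cycleGraph n).addWalk W).edges, e ∈ (cycleGraph n).edgeSet := by
    intro e he
    rcases Multiset.mem_add.1 he with h | h
    · exact mem_edgeFinset.1 h
    · exact W.edges_subset_edgeSet (Multiset.mem_coe.1 h)
  have hcount : ∀ i : Fin n,
      ((cycleGraph n).addWalk W).edges.count s(i, i + 1) = 1 + W.traversals i := by
    intro i
    have : (cycleGraph n).edgeFinset.val.count s(i, i + 1) = 1 :=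
      Multiset.count_eq_one_of_mem (Finset.nodup _)
        (mem_edgeFinset.2 ((mem_edgeSet_cycleGraph_iff hn).2 ⟨i, rfl⟩))
    simp only [addWalk, Multiset.count_add, this, Multiset.coe_count, Walk.traversals]
  have hdeg : ∀ i : Fin n, ((cycleGraph n).addWalk W).degree i =
      2 + W.traversals (i - 1) + W.traversals i := by
    intro i
    rw [LooplessMultigraph.degree, countP_mem_eq_count_add_count hn _ hsub, hcount, hcount]
    omega
  have hkey : ∀ i : Fin n, ((cycleGraph n).addWalk W).degree (i + 1) ≠
      ((cycleGraph n).addWalk W).degree (i + 1 + 1) ↔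
      W.traversals i ≠ W.traversals (i + 2) := by
    intro i
    rw [hdeg, hdeg, show i + 1 - 1 = i by ring, show i + 1 + 1 - 1 = i + 1 by ring,
      show i + 1 + 1 = i + 2 by ring]
    omega
  constructor
  · intro h i
    rw [← hkey]
    apply h
    rw [← Multiset.count_pos, hcount]
    omega
  · intro h x y hxy
    obtain ⟨i, hi⟩ := (mem_edgeSet_cycleGraph_iff hn).1 (hsub _ hxy)
    have hi' := (hkey (i - 1)).2 (h (i - 1))
    rw [sub_add_cancel] at hi'
    rcases Sym2.eq_iff.1 hi with ⟨rfl, rfl⟩ | ⟨rfl, rfl⟩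
    · exact hi'
    · exact hi'.symm

end CycleEdges

/-! ### Parity and support of the traversals -/

section Support

open scoped Fin.CommRing Fin.NatCast

variable {n : ℕ} [NeZero n]

/-- Each visit to `x` uses two edges at `x`, except at the start and at the end of the walk. -/
theorem Walk.even_traversals_add (hn : 3 ≤ n) {u w : Fin n} (W : (cycleGraph n).Walk u w)
    (x : Fin n) :
    Even (W.traversals (x - 1) + W.traversals x + (if u = x then 1 else 0) +
      if w = x then 1 else 0) := by
  induction W with
  | nil => simp only [traversals, edges_nil, List.count_nil]; split_ifs <;> decide
  | @cons u v w h W ih =>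
    obtain ⟨i, hi⟩ := (mem_edgeSet_cycleGraph_iff hn).1 ((SimpleGraph.mem_edgeSet _).2 h)
    rw [traversals_cons hn h W hi, traversals_cons hn h W hi]
    have hends : (if i = x - 1 then 1 else 0) + (if i = x then 1 else 0) =
        (if u = x then 1 else 0) + if v = x then 1 else 0 := by
      simp only [eq_sub_iff_add_eq]
      rcases Sym2.eq_iff.1 hi with ⟨rfl, rfl⟩ | ⟨rfl, rfl⟩ <;> omega
    rw [Nat.even_iff] at ih ⊢
    split_ifs at * <;> omega

/-- The edges traversed by a walk of a cycle form an arc: `ℓ` consecutive edges starting at some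
vertex `a`. The start of the walk lies on this arc; it is recorded here for the induction. -/
theorem Walk.exists_arc (hn : 3 ≤ n) {u w : Fin n} (W : (cycleGraph n).Walk u w) :
    ∃ (a : Fin n) (ℓ s : ℕ), ℓ ≤ n ∧ s ≤ ℓ ∧ u = a + (s : Fin n) ∧
      ∀ i < n, 0 < W.traversals (a + (i : Fin n)) ↔ i < ℓ := by
  induction W with
  | @nil u => exact ⟨u, 0, 0, by omega, le_rfl, by simp, by simp [traversals]⟩
  | @cons u v w h W ih =>
    -- a walk that uses every edge may take any vertex as the start of its arc
    by_cases hall : ∀ j, 0 < (cons h W).traversals j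
    · exact ⟨u, n, 0, le_rfl, by omega, by simp, fun i hi => iff_of_true (hall _) hi⟩
    obtain ⟨a, ℓ, s, hℓ, hs, rfl, hpos⟩ := ih
    have hℓn : ℓ < n := by
      by_contra hcon
      apply hall
      intro j
      obtain ⟨i, hi⟩ := (mem_edgeSet_cycleGraph_iff hn).1 ((SimpleGraph.mem_edgeSet _).2 h)
      rw [traversals_cons hn h W hi]
      have := (hpos (j - a).val (j - a).isLt).2 (by omega)
      rw [Fin.cast_val_eq_self, add_sub_cancel] at this
      omega
    rcases (cycleGraph_adj_iff hn).1 h with hu | rfl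
    · have htr := traversals_cons hn h W (i := u) (by rw [hu])
      rcases Nat.eq_zero_or_pos s with rfl | hs0
      · -- the walk starts one step before the arc
        have hua : u = a - 1 := by rw [eq_sub_iff_add_eq, ← hu]; simp
        refine ⟨u, ℓ + 1, 0, hℓn, by omega, by simp, fun i hi => ?_⟩
        rw [htr]
        rcases i with _ | i
        · simp
        · have hne : u ≠ u + ((i + 1 : ℕ) : Fin n) := fun h' =>
            fin_natCast_ne_zero (Nat.succ_pos i) hi (left_eq_add.1 h')
          rw [if_neg hne, show u + ((i + 1 : ℕ) : Fin n) = a + i by rw [hua]; push_cast; ring]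
          have := hpos i (by omega)
          omega
      · have hua : u = a + ((s - 1 : ℕ) : Fin n) := by
          have : (((s - 1 : ℕ) + 1 : ℕ) : Fin n) = s := by rw [Nat.sub_add_cancel hs0]
          push_cast at this
          linear_combination -hu - this
        refine ⟨a, ℓ, s - 1, hℓ, by omega, hua, fun i hi => ?_⟩
        rw [htr, ← hpos i hi]
        by_cases hui : u = a + (i : Fin n)
        · have := fin_natCast_inj_of_lt (by omega) hi (add_left_cancel (hua.symm.trans hui))
          have := (hpos i hi).2 (by omega)
          omega
        · rw [if_neg hui]; rfl
    · have htr := traversals_cons hn h W (i := a + (s : Fin n)) Sym2.eq_swap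
      rcases hs.lt_or_eq with hsl | rfl
      · refine ⟨a, ℓ, s + 1, hℓ, hsl, by push_cast; ring, fun i hi => ?_⟩
        rw [htr, ← hpos i hi]
        split_ifs with hsi
        · have := fin_natCast_inj_of_lt (by omega) hi (add_left_cancel hsi)
          have := (hpos i hi).2 (by omega)
          omega
        · rfl
      · -- the walk starts one step after the arc
        refine ⟨a, s + 1, s + 1, hℓn, le_rfl, by push_cast; ring, fun i hi => ?_⟩
        rw [htr]
        have := hpos i hi
        split_ifs with hsi
        · have := fin_natCast_inj_of_lt (by omega) hi (add_left_cancel hsi)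
          omega
        · have : i ≠ s := fun h' => hsi (by rw [h'])
          omega

end Support

/-! ### Sums over blocks of constant parity -/

section Sums

/-- Among odd numbers in which terms two apart differ, two terms two apart add up to at least `4`,
so the sum falls short of the average `2` by at most `1` along each residue class modulo `2`. -/
theorem two_mul_le_sum_add_two_of_odd (k : ℕ) : ∀ g : ℕ → ℕ, (∀ i < k, g i % 2 = 1) →
    (∀ i, i + 2 < k → g i ≠ g (i + 2)) → 2 * k ≤ ∑ i ∈ Finset.range k, g i + 2 := by
  induction k using Nat.strong_induction_on with
  | _ k ih =>
    intro g hodd hne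
    rcases lt_or_ge k 4 with hk | hk
    · interval_cases k
      · simp
      · simp
      · have := hodd 0 (by omega)
        have := hodd 1 (by omega)
        simp only [Finset.sum_range_succ, Finset.sum_range_zero]
        omega
      · have := hodd 0 (by omega)
        have := hodd 1 (by omega)
        have := hodd 2 (by omega)
        have : g 0 ≠ g 2 := hne 0 (by omega)
        simp only [Finset.sum_range_succ, Finset.sum_range_zero]
        omega
    · obtain ⟨k, rfl⟩ := Nat.exists_eq_add_of_le hk
      have hrec := ih k (by omega) (fun i => g (4 + i)) (fun i hi => hodd _ (by omega))
        (fun i hi => hne (4 + i) (by omega))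
      rw [Finset.sum_range_add]
      have := hodd 0 (by omega)
      have := hodd 1 (by omega)
      have := hodd 2 (by omega)
      have := hodd 3 (by omega)
      have : g 0 ≠ g 2 := hne 0 (by omega)
      have : g 1 ≠ g 3 := hne 1 (by omega)
      simp only [Finset.sum_range_succ, Finset.sum_range_zero] at *
      omega

theorem two_mul_le_sum_of_even (k : ℕ) (g : ℕ → ℕ) (heven : ∀ i < k, g i % 2 = 0)
    (hpos : ∀ i < k, 0 < g i) : 2 * k ≤ ∑ i ∈ Finset.range k, g i := by
  have := Finset.card_nsmul_le_sum (Finset.range k) g 2 fun i hi => by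
    have := heven i (Finset.mem_range.1 hi)
    have := hpos i (Finset.mem_range.1 hi)
    omega
  simpa [mul_comm] using this

/-- A positive sequence made of an even, an odd and an even block. -/
theorem two_mul_le_sum_add_two (p q r : ℕ) (g : ℕ → ℕ) (hpos : ∀ i < p + q + r, 0 < g i)
    (hne : ∀ i, i + 2 < p + q + r → g i ≠ g (i + 2))
    (hpar : ∀ i < p + q + r, g i % 2 = if i < p then 0 else if i < p + q then 1 else 0) :
    2 * (p + q + r) ≤ ∑ i ∈ Finset.range (p + q + r), g i + 2 := by
  rw [Finset.sum_range_add, Finset.sum_range_add]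
  have h1 := two_mul_le_sum_of_even p g
    (fun i hi => by rw [hpar i (by omega), if_pos hi]) (fun i hi => hpos i (by omega))
  have h2 := two_mul_le_sum_add_two_of_odd q (fun i => g (p + i))
    (fun i hi => by rw [hpar _ (by omega), if_neg (by omega), if_pos (by omega)])
    (fun i hi => hne (p + i) (by omega))
  have h3 := two_mul_le_sum_of_even r (fun i => g (p + q + i))
    (fun i hi => by rw [hpar _ (by omega), if_neg (by omega), if_neg (by omega)])
    (fun i hi => hpos _ (by omega))
  omega

/-- A positive sequence made of an odd, an even and an odd block. -/
theorem two_mul_le_sum_add_four (p q r : ℕ) (g : ℕ → ℕ) (hpos : ∀ i < p + q + r, 0 < g i)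
    (hne : ∀ i, i + 2 < p + q + r → g i ≠ g (i + 2))
    (hpar : ∀ i < p + q + r, g i % 2 = if i < p then 1 else if i < p + q then 0 else 1) :
    2 * (p + q + r) ≤ ∑ i ∈ Finset.range (p + q + r), g i + 4 := by
  rw [Finset.sum_range_add, Finset.sum_range_add]
  have h1 := two_mul_le_sum_add_two_of_odd p g
    (fun i hi => by rw [hpar i (by omega), if_pos hi]) (fun i hi => hne i (by omega))
  have h2 := two_mul_le_sum_of_even q (fun i => g (p + i))
    (fun i hi => by rw [hpar _ (by omega), if_neg (by omega), if_pos (by omega)])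
    (fun i hi => hpos _ (by omega))
  have h3 := two_mul_le_sum_add_two_of_odd r (fun i => g (p + q + i))
    (fun i hi => by rw [hpar _ (by omega), if_neg (by omega), if_neg (by omega)])
    (fun i hi => hne (p + q + i) (by omega))
  omega

end Sums

/-! ### The lower bound -/

section LowerBound

open scoped Fin.CommRing Fin.NatCast

variable {n : ℕ} [NeZero n]

/-- Number the edges starting from the arc of traversed edges, so that the at most two untraversed
edges come last. The start and the end of the walk split the numbering into three blocks of
alternating parity; each odd block loses at most `2` against an average of `2`, each untraversed
edge loses `2`, and two odd blocks occur only if every edge is traversed. -/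
theorem Walk.two_mul_le_length_add_six (hn : 3 ≤ n) {u w : Fin n} (W : (cycleGraph n).Walk u w)
    (hne : ∀ i, W.traversals i ≠ W.traversals (i + 2)) : 2 * n ≤ W.length + 6 := by
  obtain ⟨a, ℓ, -, hℓ, -, -, hpos⟩ := W.exists_arc hn
  obtain ⟨g, hg⟩ : ∃ g : ℕ → ℕ, ∀ i : ℕ, g i = W.traversals (a + (i : Fin n)) :=
    ⟨_, fun _ => rfl⟩
  have hsum : ∑ i ∈ Finset.range n, g i = W.length := by
    rw [← W.sum_traversals hn, Finset.sum_range, ← Equiv.sum_comp (Equiv.addLeft a) W.traversals]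
    exact Finset.sum_congr rfl fun i _ => by rw [hg, Fin.cast_val_eq_self, Equiv.coe_addLeft]
  have hgpos : ∀ i < n, 0 < g i ↔ i < ℓ := fun i hi => by rw [hg]; exact hpos i hi
  have hgne : ∀ i, g i ≠ g (i + 2) := fun i => by
    have := hne (a + i)
    rwa [add_assoc, show (i : Fin n) + 2 = ((i + 2 : ℕ) : Fin n) by push_cast; rfl,
      ← hg, ← hg] at this
  -- three consecutive untraversed edges are impossible
  have hℓ2 : n ≤ ℓ + 2 := by
    by_contra hcon
    have h1 := hgpos (n - 3) (by omega)
    have h2 := hgpos (n - 3 + 2) (by omega)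
    have := hgne (n - 3)
    omega
  have hend : ∀ (x : Fin n), ∀ i < n, x = a + (i : Fin n) ↔ (x - a).val = i := by
    intro x i hi
    rw [← sub_eq_iff_eq_add', Fin.ext_iff, Fin.val_natCast, Nat.mod_eq_of_lt hi]
  -- parity changes only at the start and at the end of the walk
  have hpar : ∀ i < n, (g i + g (n - 1) + (if (u - a).val ≤ i then 1 else 0) +
      if (w - a).val ≤ i then 1 else 0) % 2 = 0 := by
    intro i
    induction i with
    | zero =>
      intro hi
      have h := W.even_traversals_add hn (a + ((0 : ℕ) : Fin n))
      have hlast : a + ((0 : ℕ) : Fin n) - 1 = a + ((n - 1 : ℕ) : Fin n) := by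
        rw [Nat.cast_sub (by omega), fin_natCast_self]; push_cast; ring
      rw [hlast, ← hg, ← hg, Nat.even_iff] at h
      simp only [hend _ 0 hi] at h
      simp only [Nat.le_zero]
      omega
    | succ i ih =>
      intro hi
      have h := W.even_traversals_add hn (a + ((i + 1 : ℕ) : Fin n))
      have hprev : a + ((i + 1 : ℕ) : Fin n) - 1 = a + (i : Fin n) := by push_cast; ring
      rw [hprev, ← hg, ← hg, Nat.even_iff] at h
      simp only [hend _ _ hi] at h
      have := ih (by omega)
      split_ifs at * <;> omega
  have hu := (u - a).isLt
  have hw := (w - a).isLt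
  generalize (u - a).val = s at *
  generalize (w - a).val = t at *
  rcases Nat.even_or_odd' (g (n - 1)) with ⟨c, hc | hc⟩
  · -- the blocks are even, odd, even; the last two edges, possibly untraversed, are left out
    obtain ⟨p, hp⟩ : ∃ p, p = min (min s t) (n - 2) := ⟨_, rfl⟩
    obtain ⟨q, hq⟩ : ∃ q, q = min (max s t) (n - 2) := ⟨_, rfl⟩
    have h := two_mul_le_sum_add_two p (q - p) (n - 2 - q) g
      (fun i hi => (hgpos i (by omega)).2 (by omega)) (fun i _ => hgne i)
      (fun i hi => by
        have := hpar i (by omega)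
        split_ifs at * <;> omega)
    rw [show p + (q - p) + (n - 2 - q) = n - 2 by omega] at h
    have hle : ∑ i ∈ Finset.range (n - 2), g i ≤ ∑ i ∈ Finset.range n, g i :=
      Finset.sum_le_sum_of_subset (Finset.range_mono (by omega))
    omega
  · -- the blocks are odd, even, odd; all edges are traversed
    have hℓn : ℓ = n := by
      have := hgpos (n - 1) (by omega)
      omega
    have h := two_mul_le_sum_add_four (min s t) (max s t - min s t) (n - max s t) g
      (fun i hi => (hgpos i (by omega)).2 (by omega)) (fun i _ => hgne i)
      (fun i hi => by
        have := hpar i (by omega)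
        split_ifs at * <;> omega)
    rw [show min s t + (max s t - min s t) + (n - max s t) = n by omega] at h
    omega

theorem Walk.three_le_length {u w : Fin 3} (W : (cycleGraph 3).Walk u w)
    (hne : ∀ i, W.traversals i ≠ W.traversals (i + 2)) : 3 ≤ W.length := by
  rw [← W.sum_traversals le_rfl, Fin.sum_univ_three]
  have h0 : W.traversals 0 ≠ W.traversals 2 := hne 0
  have h1 : W.traversals 1 ≠ W.traversals 0 := hne 1
  have h2 : W.traversals 2 ≠ W.traversals 1 := hne 2
  omega

end LowerBound

/-! ### An irregularising walk of optimal length -/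

section Construction

open scoped Fin.CommRing Fin.NatCast

variable {n : ℕ} [NeZero n]

/-- There is a walk of length `L` in the cycle that ends at the vertex `q` and traverses the edge
between `i` and `i + 1` exactly `f i` times, for every `i < n`. -/
def HasCycleWalk (n : ℕ) [NeZero n] (q : ℕ) (f : ℕ → ℕ) (L : ℕ) : Prop :=
  ∃ (u : Fin n) (W : (cycleGraph n).Walk u (q : Fin n)), W.length = L ∧
    ∀ i < n, W.traversals (i : Fin n) = f i

theorem HasCycleWalk.congr {q L : ℕ} {f g : ℕ → ℕ} (h : HasCycleWalk n q f L)
    (hfg : ∀ i, f i = g i) : HasCycleWalk n q g L := by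
  rwa [← funext hfg]

theorem hasCycleWalk_zero (q : ℕ) : HasCycleWalk n q (fun _ => 0) 0 :=
  ⟨_, Walk.nil, rfl, fun _ _ => by simp [Walk.traversals]⟩

theorem Walk.traversals_concat (hn : 3 ≤ n) {u v w : Fin n} {q i : ℕ} (hq : q < n) (hi : i < n)
    (W : (cycleGraph n).Walk u v) (h : (cycleGraph n).Adj v w)
    (he : s(v, w) = s((q : Fin n), (q : Fin n) + 1)) :
    (W.concat h).traversals (i : Fin n) =
      W.traversals (i : Fin n) + if i = q then 1 else 0 := by
  have hqi : (q : Fin n) = i ↔ i = q :=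
    ⟨fun h => (fin_natCast_inj_of_lt hq hi h).symm, fun h => by rw [h]⟩
  simp only [traversals, edges_concat, List.concat_eq_append, List.count_append, he,
    List.count_singleton, beq_iff_eq, cycleEdge_inj hn, hqi]

theorem HasCycleWalk.forward (hn : 3 ≤ n) {q L : ℕ} {f : ℕ → ℕ} (hq : q < n)
    (h : HasCycleWalk n q f L) :
    HasCycleWalk n (q + 1) (fun i => f i + if i = q then 1 else 0) (L + 1) := by
  obtain ⟨u, W, rfl, hW⟩ := h
  have he : s((q : Fin n), ((q + 1 : ℕ) : Fin n)) = s((q : Fin n), (q : Fin n) + 1) := by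
    push_cast; rfl
  have hadj : (cycleGraph n).Adj (q : Fin n) ((q + 1 : ℕ) : Fin n) :=
    (cycleGraph_adj_iff hn).2 (Or.inl (by push_cast; rfl))
  exact ⟨u, W.concat hadj, Walk.length_concat _ _, fun i hi => by
    rw [Walk.traversals_concat hn hq hi W hadj he, hW i hi]⟩

theorem HasCycleWalk.backward (hn : 3 ≤ n) {q L : ℕ} {f : ℕ → ℕ} (hq : q < n)
    (h : HasCycleWalk n (q + 1) f L) :
    HasCycleWalk n q (fun i => f i + if i = q then 1 else 0) (L + 1) := by
  obtain ⟨u, W, rfl, hW⟩ := h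
  have he : s(((q + 1 : ℕ) : Fin n), (q : Fin n)) = s((q : Fin n), (q : Fin n) + 1) := by
    push_cast; exact Sym2.eq_swap
  have hadj : (cycleGraph n).Adj ((q + 1 : ℕ) : Fin n) (q : Fin n) :=
    (cycleGraph_adj_iff hn).2 (Or.inr (by push_cast; rfl))
  exact ⟨u, W.concat hadj, Walk.length_concat _ _, fun i hi => by
    rw [Walk.traversals_concat hn hq hi W hadj he, hW i hi]⟩

/-- The numbers of traversals, edge by edge, of an optimal walk: `a` twos, then `1, 1`
followed by `j` copies of `3, 3, 1, 1`, then `b` twos, then zeros. -/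
def traversalPattern (a j b i : ℕ) : ℕ :=
  if i < a then 2 else if i < a + 2 + 4 * j then (if (i - a) % 4 < 2 then 1 else 3)
    else if i < a + 2 + 4 * j + b then 2 else 0

/-- Two steps forward, two back and four forward prolong the pattern by one block `3, 3, 1, 1`. -/
theorem HasCycleWalk.zigzag (hn : 3 ≤ n) {a j : ℕ} (h : a + 4 * j + 6 ≤ n)
    (hw : HasCycleWalk n (a + 2 + 4 * j) (traversalPattern a j 0) (2 * a + 2 + 8 * j)) :
    HasCycleWalk n (a + 2 + 4 * (j + 1)) (traversalPattern a (j + 1) 0)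
      (2 * a + 2 + 8 * (j + 1)) := by
  have h2 := (((((((hw.forward hn (by omega)).forward hn (by omega)).backward hn
    (by omega)).backward hn (by omega)).forward hn (by omega)).forward hn (by omega)).forward hn
    (by omega)).forward hn (by omega)
  refine h2.congr fun i => ?_
  simp only [traversalPattern]
  split_ifs <;> omega

theorem hasCycleWalk_traversalPattern (hn : 3 ≤ n) {a j : ℕ} (ha : a ≤ 1)
    (h : a + 4 * j + 2 ≤ n) :
    HasCycleWalk n (a + 2 + 4 * j) (traversalPattern a j 0) (2 * a + 2 + 8 * j) := by
  induction j with
  | succ j ih => exact (ih (by omega)).zigzag hn (by omega)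
  | zero =>
    interval_cases a
    · refine (((hasCycleWalk_zero 0).forward hn (by omega)).forward hn (by omega)).congr
        fun i => ?_
      simp only [traversalPattern]
      split_ifs <;> omega
    · refine (((((hasCycleWalk_zero 1).backward hn (by omega)).forward hn (by omega)).forward hn
        (by omega)).forward hn (by omega)).congr fun i => ?_
      simp only [traversalPattern]
      split_ifs <;> omega

theorem exists_hasCycleWalk_traversalPattern (hn : 3 ≤ n) {a j b : ℕ} (ha : a ≤ 1) (hb : b ≤ 2)
    (h : a + 4 * j + 2 + b ≤ n) :
    ∃ q, HasCycleWalk n q (traversalPattern a j b) (2 * a + 2 + 8 * j + 2 * b) := by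
  have hw := hasCycleWalk_traversalPattern hn ha (j := j) (by omega)
  interval_cases b
  · exact ⟨_, hw⟩
  · refine ⟨_, ((hw.forward hn (by omega)).backward hn (by omega)).congr fun i => ?_⟩
    simp only [traversalPattern]
    split_ifs <;> omega
  · refine ⟨_, ((((hw.forward hn (by omega)).forward hn (by omega)).backward hn
      (by omega)).backward hn (by omega)).congr fun i => ?_⟩
    simp only [traversalPattern]
    split_ifs <;> omega

theorem HasCycleWalk.exists_irregularising (hn : 3 ≤ n) {q L : ℕ} {f : ℕ → ℕ}
    (h : HasCycleWalk n q f L) (hf : ∀ i < n, f i ≠ f ((i + 2) % n)) :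
    ∃ (u v : Fin n) (W : (cycleGraph n).Walk u v),
      (cycleGraph n).IsIrregularisingWalk W ∧ W.length = L := by
  obtain ⟨u, W, hL, hW⟩ := h
  refine ⟨u, _, W, (isIrregularisingWalk_cycleGraph_iff hn W).2 fun i => ?_, hL⟩
  have h1 := hW i i.isLt
  have h2 := hW ((i + 2) % n) (Nat.mod_lt _ (by omega))
  rw [Fin.cast_val_eq_self] at h1
  have hcast : ((((i : ℕ) + 2) % n : ℕ) : Fin n) = i + 2 := by
    have hmod : ((((i : ℕ) + 2) % n : ℕ) : Fin n) = (((i : ℕ) + 2 : ℕ) : Fin n) := by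
      ext
      simp only [Fin.val_natCast, Nat.mod_mod]
    rw [hmod, Nat.cast_add, Fin.cast_val_eq_self]
    rfl
  rw [hcast] at h2
  rw [h1, h2]
  exact hf i i.isLt

theorem exists_irregularising_cycleGraph (hn : 4 ≤ n) :
    ∃ (u v : Fin n) (W : (cycleGraph n).Walk u v),
      (cycleGraph n).IsIrregularisingWalk W ∧ W.length = 2 * n - 6 := by
  -- the last two edges are untraversed, and `a + b` is the residue of `n` modulo `4`
  obtain ⟨a, j, b, ha, hb, rfl⟩ : ∃ a j b : ℕ, a ≤ 1 ∧ b ≤ 2 ∧ n = a + 2 + 4 * j + b + 2 :=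
    ⟨(n - 4) % 4 / 3, (n - 4) / 4, (n - 4) % 4 - (n - 4) % 4 / 3, by omega, by omega, by omega⟩
  obtain ⟨q, h⟩ := exists_hasCycleWalk_traversalPattern (n := a + 2 + 4 * j + b + 2) (j := j)
    (by omega) ha hb (by omega)
  rw [show 2 * (a + 2 + 4 * j + b + 2) - 6 = 2 * a + 2 + 8 * j + 2 * b by omega]
  refine h.exists_irregularising (by omega) fun i hi => ?_
  have hmod : (i + 2) % (a + 2 + 4 * j + b + 2) = if i < a + 2 + 4 * j + b then i + 2
      else i - (a + 2 + 4 * j + b) := by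
    split_ifs
    · exact Nat.mod_eq_of_lt (by omega)
    · rw [Nat.mod_eq_sub_mod (by omega), Nat.mod_eq_of_lt (by omega)]
      omega
  rw [hmod]
  simp only [traversalPattern]
  split_ifs <;> omega

theorem exists_irregularising_cycleGraph_three :
    ∃ (u v : Fin 3) (W : (cycleGraph 3).Walk u v),
      (cycleGraph 3).IsIrregularisingWalk W ∧ W.length = 3 := by
  -- the walk `0, 1, 2, 1`
  have h : HasCycleWalk 3 1 _ 3 := (((hasCycleWalk_zero 0).forward le_rfl (by omega)).forward
    le_rfl (by omega)).backward le_rfl (by omega)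
  exact h.exists_irregularising le_rfl (by decide)

end Construction

/-! ### The minimum length -/

theorem minIrregularisingWalkLength_eq {V : Type*} [Fintype V] [DecidableEq V]
    (G : SimpleGraph V) [DecidableRel G.Adj] {L : ℕ} (hL : 1 ≤ L)
    (hex : ∃ (u v : V) (W : G.Walk u v), G.IsIrregularisingWalk W ∧ W.length = L)
    (hle : ∀ (u v : V) (W : G.Walk u v), G.IsIrregularisingWalk W → L ≤ W.length) :
    G.minIrregularisingWalkLength = L := by
  refine IsLeast.csInf_eq ⟨⟨by exact_mod_cast hL, ?_⟩, ?_⟩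
  · obtain ⟨u, v, W, hW, rfl⟩ := hex
    exact ⟨u, v, W, hW, rfl⟩
  · rintro _ ⟨-, u, v, W, hW, rfl⟩
    exact_mod_cast hle u v W hW

end SimpleGraph

theorem corollary5p6 (n : ℕ) (hn : 3 ≤ n) :
    (SimpleGraph.cycleGraph n).minIrregularisingWalkLength =
      if n = 3 then 3 else ((2 * n - 6 : ℕ) : ℕ∞) := by
  have : NeZero n := ⟨by omega⟩
  split_ifs with h
  · subst h
    exact SimpleGraph.minIrregularisingWalkLength_eq _ (L := 3) (by omega)
      SimpleGraph.exists_irregularising_cycleGraph_three fun u v W hW =>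
        W.three_le_length ((SimpleGraph.isIrregularisingWalk_cycleGraph_iff hn W).1 hW)
  · refine SimpleGraph.minIrregularisingWalkLength_eq _ (by omega)
      (SimpleGraph.exists_irregularising_cycleGraph (by omega)) fun u v W hW => ?_
    have := W.two_mul_le_length_add_six hn
      ((SimpleGraph.isIrregularisingWalk_cycleGraph_iff hn W).1 hW)
    omega
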